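/- All Hilbert spaces are finite-dimensional. A system is called trivial ($\mathsf I$) if its Hilbert space has dimension one; classical ($\mathsf C$) if its dimension is at least two and its operators are exactly the matrices that are diagonal in a fixed basis; and quantum ($\mathsf Q$) if its dimension is at least two and all matrices are allowed as operators. The type of a bipartite resource specifies which of $\mathsf I$, $\mathsf C$, $\mathsf Q$ each of Alice's input $X$, Bob's input $Y$, Alice's output $A$ and Bob's output $B$ is; it does not fix the dimensions. A resource of a given type is a completely positive trace-preserving (CPTP) map $\mathcal E$ from the operators on $X\otimes Y$ to the operators on $A\otimes B$, for systems $X,Y,A,B$ of the prescribed kinds and of any dimensions, that is nonsignaling in both directions: $\mathrm{Tr}_A\,\mathcal E(M)$ depends only on $\mathrm{Tr}_X M$, and $\mathrm{Tr}_B\,\mathcal E(M)$ depends only on $\mathrm{Tr}_Y M$. It can be generated by local operations and shared entanglement (LOSE) if there are quantum systems $K$, $L$, a density operator $\sigma$ on $K\otimes L$, and CPTP maps $\mathcal F: X\otimes K\to A$ and $\mathcal G: L\otimes Y\to B$ such that $\mathcal E(M)=(\mathcal F\otimes\mathcal G)(M\otimes\sigma)$ for all $M$ (with the tensor factors reordered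 appropriately). A type is LOSE-trivial if every resource of that type can be generated by LOSE. **Theorem.** A bipartite resource type is LOSE-trivial if and only if at least one of its inputs and outputs $X,Y,A,B$ is trivial. -/

import Mathlib

open scoped Kronecker ComplexOrder

noncomputable section

namespace LOSE

/-! ### Linear maps on matrix algebras

The space of operators on a Hilbert space with orthonormal basis `m` is `Matrix m m ℂ`; the tensor
product of two Hilbert spaces has the basis `m × n`. -/

section MatrixMaps

variable {m n p q : Type*} [Fintype m] [DecidableEq m] [Fintype n] [DecidableEq n]
  [Fintype p] [DecidableEq p] [Fintype q] [DecidableEq q]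

/-- The tensor product `Φ ⊗ Ψ` of two maps on operators: it is the linear map that sends the
Kronecker product `M ⊗ₖ N` to `Φ M ⊗ₖ Ψ N`. -/
def tensorMap (Φ : Matrix m m ℂ →ₗ[ℂ] Matrix p p ℂ) (Ψ : Matrix n n ℂ →ₗ[ℂ] Matrix q q ℂ) :
    Matrix (m × n) (m × n) ℂ →ₗ[ℂ] Matrix (p × q) (p × q) ℂ :=
  (kroneckerLinearEquiv p p q q ℂ).toLinearMap ∘ₗ TensorProduct.map Φ Ψ ∘ₗ
    (kroneckerLinearEquiv m m n n ℂ).symm.toLinearMap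

/-- Completely positive trace preserving maps. -/
structure IsCPTP (Φ : Matrix m m ℂ →ₗ[ℂ] Matrix p p ℂ) : Prop where
  completelyPositive : ∀ (k : ℕ) (M : Matrix (Fin k × m) (Fin k × m) ℂ), M.PosSemidef →
    (tensorMap (LinearMap.id : Matrix (Fin k) (Fin k) ℂ →ₗ[ℂ] Matrix (Fin k) (Fin k) ℂ)
      Φ M).PosSemidef
  tracePreserving : ∀ M : Matrix m m ℂ, (Φ M).trace = M.trace

/-- Density operators. -/
def IsDensity (ρ : Matrix m m ℂ) : Prop := ρ.PosSemidef ∧ ρ.trace = 1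

/-- Partial trace over the first tensor factor. -/
def traceFst (M : Matrix (m × n) (m × n) ℂ) : Matrix n n ℂ :=
  Matrix.of fun j j' => ∑ i, M (i, j) (i, j')

/-- Partial trace over the second tensor factor. -/
def traceSnd (M : Matrix (m × n) (m × n) ℂ) : Matrix m m ℂ :=
  Matrix.of fun i i' => ∑ j, M (i, j) (i', j)

end MatrixMaps

/-! ### Systems and resource types -/

/-- The three kinds of input and output systems: trivial `I`, classical `C`, quantum `Q`. -/
inductive Kind where
  | I
  | C
  | Q

/-- The Hilbert space dimensions that a system of a given kind can have. -/
def Kind.AllowsDim : Kind → ℕ → Prop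
  | .I, d => d = 1
  | .C, d => 2 ≤ d
  | .Q, d => 2 ≤ d

/-- The projection of all matrices onto the operators of a system of kind `κ`. All operators of a
classical system are diagonal, so for it this is the dephasing map, which keeps the diagonal part
of a matrix; otherwise it is the identity. -/
def Kind.proj (κ : Kind) {n : Type*} [DecidableEq n] : Matrix n n ℂ →ₗ[ℂ] Matrix n n ℂ :=
  match κ with
  | .I => LinearMap.id
  | .C => Matrix.diagonalLinearMap n ℂ ℂ ∘ₗ Matrix.diagLinearMap n ℂ ℂ
  | .Q => LinearMap.id

/-- The global type of a bipartite resource: the kinds of the input `X` and output `A` of Alice,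
and of the input `Y` and output `B` of Bob. -/
structure ResourceType where
  X : Kind
  Y : Kind
  A : Kind
  B : Kind

section NoSignaling

variable {x y a b : Type*}

/-- Alice cannot signal to Bob: the reduced output of Bob depends only on his reduced input. -/
def NoSignalAliceToBob [Fintype x] [Fintype a]
    (E : Matrix (x × y) (x × y) ℂ →ₗ[ℂ] Matrix (a × b) (a × b) ℂ) : Prop :=
  ∀ M N, traceFst M = traceFst N → traceFst (E M) = traceFst (E N)

/-- Bob cannot signal to Alice: the reduced output of Alice depends only on her reduced input. -/
def NoSignalBobToAlice [Fintype y] [Fintype b]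
    (E : Matrix (x × y) (x × y) ℂ →ₗ[ℂ] Matrix (a × b) (a × b) ℂ) : Prop :=
  ∀ M N, traceSnd M = traceSnd N → traceSnd (E M) = traceSnd (E N)

end NoSignaling

section Resources

variable {x y a b : ℕ}

/-- `E` is a resource of type `T`, with inputs of dimensions `x` (Alice), `y` (Bob) and outputs of
dimensions `a` (Alice), `b` (Bob): a nonsignaling CPTP map between the operators of these systems.
A map from the operators of the inputs to the operators of the outputs is represented by its unique
extension to all matrices that factors through the projection onto the operators of the inputs. -/
structure IsResource (T : ResourceType)
    (E : Matrix (Fin x × Fin y) (Fin x × Fin y) ℂ →ₗ[ℂ]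
      Matrix (Fin a × Fin b) (Fin a × Fin b) ℂ) : Prop where
  dimX : T.X.AllowsDim x
  dimY : T.Y.AllowsDim y
  dimA : T.A.AllowsDim a
  dimB : T.B.AllowsDim b
  cptp : IsCPTP E
  input : E ∘ₗ tensorMap T.X.proj T.Y.proj = E
  output : tensorMap T.A.proj T.B.proj ∘ₗ E = E
  noSignalAliceToBob : NoSignalAliceToBob E
  noSignalBobToAlice : NoSignalBobToAlice E

/-- A local operation of Alice: a channel from her input together with her `k`-dimensional
part of the shared quantum state to her output. -/
structure IsAliceOperation (T : ResourceType) {k : ℕ}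
    (F : Matrix (Fin x × Fin k) (Fin x × Fin k) ℂ →ₗ[ℂ] Matrix (Fin a) (Fin a) ℂ) : Prop where
  cptp : IsCPTP F
  input : F ∘ₗ tensorMap T.X.proj LinearMap.id = F
  output : T.A.proj ∘ₗ F = F

/-- A local operation of Bob: a channel from his `l`-dimensional part of the shared quantum state
together with his input to his output. -/
structure IsBobOperation (T : ResourceType) {l : ℕ}
    (G : Matrix (Fin l × Fin y) (Fin l × Fin y) ℂ →ₗ[ℂ] Matrix (Fin b) (Fin b) ℂ) : Prop where
  cptp : IsCPTP G
  input : G ∘ₗ tensorMap LinearMap.id T.Y.proj = G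
  output : T.B.proj ∘ₗ G = G

/-- The operator `M ⊗ σ` for an operator `M` on the inputs `x`, `y` and the shared state `σ`
on `k`, `l`, with the tensor factors reordered as `(x, k), (l, y)`. -/
def insertShared {k l : ℕ} (σ : Matrix (Fin k × Fin l) (Fin k × Fin l) ℂ)
    (M : Matrix (Fin x × Fin y) (Fin x × Fin y) ℂ) :
    Matrix ((Fin x × Fin k) × (Fin l × Fin y)) ((Fin x × Fin k) × (Fin l × Fin y)) ℂ :=
  Matrix.of fun r s =>
    M (r.1.1, r.2.2) (s.1.1, s.2.2) * σ (r.1.2, r.2.1) (s.1.2, s.2.1)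

/-- A resource `E` of type `T` can be generated by local operations and shared entanglement. -/
def IsLOSEFree (T : ResourceType)
    (E : Matrix (Fin x × Fin y) (Fin x × Fin y) ℂ →ₗ[ℂ]
      Matrix (Fin a × Fin b) (Fin a × Fin b) ℂ) : Prop :=
  ∃ (k l : ℕ) (σ : Matrix (Fin k × Fin l) (Fin k × Fin l) ℂ)
    (F : Matrix (Fin x × Fin k) (Fin x × Fin k) ℂ →ₗ[ℂ] Matrix (Fin a) (Fin a) ℂ)
    (G : Matrix (Fin l × Fin y) (Fin l × Fin y) ℂ →ₗ[ℂ] Matrix (Fin b) (Fin b) ℂ),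
    IsDensity σ ∧ IsAliceOperation T F ∧ IsBobOperation T G ∧
      ∀ M, E M = tensorMap F G (insertShared σ M)

end Resources

/-- A type is LOSE-trivial if every resource of that type can be generated by local operations and
shared entanglement. -/
def ResourceType.IsLOSETrivial (T : ResourceType) : Prop :=
  ∀ (x y a b : ℕ) (E : Matrix (Fin x × Fin y) (Fin x × Fin y) ℂ →ₗ[ℂ]
      Matrix (Fin a × Fin b) (Fin a × Fin b) ℂ), IsResource T E → IsLOSEFree T E

end LOSE

end

/-!
A resource with a trivial input or output is generated by LOSE for structural reasons. If Alice's
output is trivial, nonsignaling says that Bob's output depends only on his input, so Bob can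
simulate the whole resource (`LOSE.isLOSETrivial_of_A`). If Alice's input is trivial,
nonsignaling says that her output state `ρ` does not depend on Bob's input; then the two share a
purification of `ρ`, Alice outputs her half, and by the uniqueness of purifications a channel of
Bob on his half and his input completes it to the output of the resource
(`LOSE.exists_factorization`, `LOSE.isLOSETrivial_of_X`).
The two other cases follow by exchanging the parties (`LOSE.isLOSETrivial_of_swap`).

Conversely, if no system is trivial, then the Popescu–Rohrlich box on two-dimensional systems is a
resource of the type, as it reads only the diagonal of its input and has diagonal output
(`LOSE.isResource_prBox`). Fixing basis states as inputs turns the local operations of a LOSE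
protocol into measurements on the shared state, so the protocol would realize the CHSH
value `4`, while quantum correlations have CHSH value at most `3`
(`LOSE.chsh_le_three`, `LOSE.not_isLOSEFree_prBox`).

Complete positivity enters through Kraus operators (`LOSE.IsCPTP.exists_kraus`,
`LOSE.IsCPTP.of_kraus`). That local operations respect the kinds of the systems can be ignored when
building protocols, since the projections of the kinds can be applied afterwards
(`LOSE.IsResource.isLOSEFree`).
-/

namespace LOSE

open Matrix

/-! ### Kraus representations -/

section Kraus

variable {m n p q r s ι κ : Type*} [Fintype m] [DecidableEq m] [Fintype n] [DecidableEq n]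
  [Fintype p] [DecidableEq p] [Fintype q] [DecidableEq q] [Fintype r] [DecidableEq r]
  [Fintype s] [DecidableEq s] [Fintype ι] [Fintype κ]

/-- Linear maps out of a matrix algebra on a tensor product agree if they agree on Kronecker
products. -/
theorem ext_kronecker {V : Type*} [AddCommMonoid V] [Module ℂ V]
    {f g : Matrix (m × n) (m × n) ℂ →ₗ[ℂ] V}
    (h : ∀ (A : Matrix m m ℂ) (B : Matrix n n ℂ), f (A ⊗ₖ B) = g (A ⊗ₖ B)) : f = g := by
  have h' : f ∘ₗ (kroneckerLinearEquiv m m n n ℂ).toLinearMap =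
      g ∘ₗ (kroneckerLinearEquiv m m n n ℂ).toLinearMap := TensorProduct.ext' (by simpa using h)
  ext1 M
  simpa using LinearMap.congr_fun h' ((kroneckerLinearEquiv m m n n ℂ).symm M)

@[simp]
theorem tensorMap_kronecker (Φ : Matrix m m ℂ →ₗ[ℂ] Matrix p p ℂ)
    (Ψ : Matrix n n ℂ →ₗ[ℂ] Matrix q q ℂ) (A : Matrix m m ℂ) (B : Matrix n n ℂ) :
    tensorMap Φ Ψ (A ⊗ₖ B) = Φ A ⊗ₖ Ψ B := by
  simp [tensorMap]

theorem tensorMap_comp (Φ : Matrix m m ℂ →ₗ[ℂ] Matrix p p ℂ)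
    (Ψ : Matrix n n ℂ →ₗ[ℂ] Matrix q q ℂ) (Φ' : Matrix p p ℂ →ₗ[ℂ] Matrix r r ℂ)
    (Ψ' : Matrix q q ℂ →ₗ[ℂ] Matrix s s ℂ) :
    tensorMap Φ' Ψ' ∘ₗ tensorMap Φ Ψ = tensorMap (Φ' ∘ₗ Φ) (Ψ' ∘ₗ Ψ) :=
  ext_kronecker fun A B => by simp

/-- The completely positive map `M ↦ ∑ i, K i * M * (K i)ᴴ` with Kraus operators `K i`. -/
def krausMap (K : ι → Matrix p m ℂ) : Matrix m m ℂ →ₗ[ℂ] Matrix p p ℂ where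
  toFun M := ∑ i, K i * M * (K i)ᴴ
  map_add' M N := by simp [Matrix.mul_add, Matrix.add_mul, Finset.sum_add_distrib]
  map_smul' c M := by simp [Finset.smul_sum]

omit [DecidableEq m] [Fintype p] [DecidableEq p] in
theorem krausMap_apply (K : ι → Matrix p m ℂ) (M : Matrix m m ℂ) :
    krausMap K M = ∑ i, K i * M * (K i)ᴴ := rfl

theorem tensorMap_krausMap (K : ι → Matrix p m ℂ) (L : κ → Matrix q n ℂ) :
    tensorMap (krausMap K) (krausMap L) = krausMap fun i : ι × κ => K i.1 ⊗ₖ L i.2 := by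
  refine ext_kronecker fun A B => ?_
  rw [tensorMap_kronecker]
  simp only [krausMap_apply, Fintype.sum_prod_type, conjTranspose_kronecker, ← mul_kronecker_mul]
  ext ⟨i, j⟩ ⟨i', j'⟩
  simp only [kronecker_apply, Matrix.sum_apply, Finset.sum_mul_sum]

omit [DecidableEq m] [DecidableEq p] [Fintype q] [DecidableEq q] in
theorem krausMap_comp (K : ι → Matrix p m ℂ) (L : κ → Matrix q p ℂ) :
    krausMap L ∘ₗ krausMap K = krausMap fun i : κ × ι => L i.1 * K i.2 := by
  ext1 M
  simp only [LinearMap.comp_apply, krausMap_apply, Fintype.sum_prod_type, Matrix.mul_sum,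
    Matrix.sum_mul, Matrix.mul_assoc, conjTranspose_mul]

theorem krausMap_one : krausMap (fun _ : Unit => (1 : Matrix m m ℂ)) = LinearMap.id := by
  ext1 M
  simp [krausMap_apply]

omit [DecidableEq m] [DecidableEq p] in
theorem posSemidef_krausMap (K : ι → Matrix p m ℂ) {M : Matrix m m ℂ} (hM : M.PosSemidef) :
    (krausMap K M).PosSemidef :=
  posSemidef_sum _ fun i _ => hM.mul_mul_conjTranspose_same (K i)

omit [DecidableEq m] [DecidableEq p] in
theorem trace_krausMap (K : ι → Matrix p m ℂ) (M : Matrix m m ℂ) :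
    (krausMap K M).trace = (M * ∑ i, (K i)ᴴ * K i).trace := by
  simp only [krausMap_apply, Matrix.mul_sum, trace_sum]
  refine Finset.sum_congr rfl fun i _ => ?_
  rw [Matrix.mul_assoc, trace_mul_comm, Matrix.mul_assoc]

theorem IsCPTP.of_kraus (K : ι → Matrix p m ℂ)
    (h : ∀ M, (krausMap K M).trace = M.trace) : IsCPTP (krausMap K) where
  completelyPositive k M hM := by
    rw [← krausMap_one, tensorMap_krausMap]
    exact posSemidef_krausMap _ hM
  tracePreserving := h

theorem IsCPTP.of_sum_eq_one (K : ι → Matrix p m ℂ) (h : ∑ i, (K i)ᴴ * K i = 1) :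
    IsCPTP (krausMap K) :=
  .of_kraus K fun M => by rw [trace_krausMap, h, Matrix.mul_one]

theorem isCPTP_conj (V : Matrix p m ℂ) (h : Vᴴ * V = 1) :
    IsCPTP (krausMap fun _ : Unit => V) :=
  .of_sum_eq_one _ (by simpa using h)

/-- Choi's theorem: the matrix obtained by applying `id ⊗ Φ` to the unnormalised maximally
entangled state is positive semidefinite, and the columns of a Gram factor of it are the Kraus
operators. -/
theorem IsCPTP.exists_kraus {Φ : Matrix m m ℂ →ₗ[ℂ] Matrix p p ℂ} (h : IsCPTP Φ) :
    ∃ (t : ℕ) (K : Fin t → Matrix p m ℂ), Φ = krausMap K := by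
  let e := Fintype.equivFin m
  let v : Fin (Fintype.card m) × m → ℂ := fun i => if i.1 = e i.2 then 1 else 0
  have hC := h.completelyPositive _ _ (posSemidef_vecMulVec_self_star v)
  have hv : vecMulVec v (star v) =
      ∑ j, ∑ j', single (e j) (e j') (1 : ℂ) ⊗ₖ single j j' (1 : ℂ) := by
    ext ⟨i, j⟩ ⟨i', j'⟩
    simp only [Matrix.sum_apply, kronecker_apply, single_apply, vecMulVec_apply, v, Pi.star_apply]
    rw [Finset.sum_eq_single j (by intros; simp_all) (by simp),
      Finset.sum_eq_single j' (by intros; simp_all) (by simp)]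
    by_cases h1 : i = e j <;> by_cases h2 : i' = e j' <;> simp [h1, h2, Ne.symm]
  rw [hv] at hC
  simp only [map_sum, tensorMap_kronecker, LinearMap.id_apply] at hC
  obtain ⟨t, B, hB⟩ := posSemidef_iff_eq_sum_vecMulVec.mp hC
  refine ⟨t, fun i => of fun a j => B i (e j, a), ?_⟩
  have key : ∀ j j', Φ (single j j' 1) =
      krausMap (fun i => of fun a j => B i (e j, a)) (single j j' 1) := by
    intro j j'
    ext a a'
    have := congrFun (congrFun hB (e j, a)) (e j', a')
    simp only [Matrix.sum_apply, kronecker_apply, single_apply, vecMulVec_apply,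
      Pi.star_apply] at this
    rw [Finset.sum_eq_single j (by intros; simp_all) (by simp),
      Finset.sum_eq_single j' (by intros; simp_all) (by simp)] at this
    simp only [and_self, if_true, one_mul] at this
    rw [this]
    simp [krausMap_apply, Matrix.sum_apply, Matrix.mul_apply, single_apply, ite_and]
  refine Matrix.ext_linearMap ℂ fun j j' => ?_
  ext1
  simpa using key j j'

theorem IsCPTP.id : IsCPTP (LinearMap.id : Matrix m m ℂ →ₗ[ℂ] Matrix m m ℂ) := by
  rw [← krausMap_one]
  exact isCPTP_conj _ (by simp)

theorem IsCPTP.comp {Φ : Matrix m m ℂ →ₗ[ℂ] Matrix p p ℂ} {Ψ : Matrix p p ℂ →ₗ[ℂ] Matrix q q ℂ}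
    (hΨ : IsCPTP Ψ) (hΦ : IsCPTP Φ) : IsCPTP (Ψ ∘ₗ Φ) := by
  have ht : ∀ M, ((Ψ ∘ₗ Φ) M).trace = M.trace := fun M => by
    rw [LinearMap.comp_apply, hΨ.tracePreserving, hΦ.tracePreserving]
  obtain ⟨_, K, rfl⟩ := hΦ.exists_kraus
  obtain ⟨_, L, rfl⟩ := hΨ.exists_kraus
  rw [krausMap_comp] at ht ⊢
  exact .of_kraus _ ht

theorem IsCPTP.tensorMap {Φ : Matrix m m ℂ →ₗ[ℂ] Matrix p p ℂ}
    {Ψ : Matrix n n ℂ →ₗ[ℂ] Matrix q q ℂ} (hΦ : IsCPTP Φ) (hΨ : IsCPTP Ψ) :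
    IsCPTP (tensorMap Φ Ψ) := by
  have ht : traceLinearMap _ ℂ ℂ ∘ₗ LOSE.tensorMap Φ Ψ = traceLinearMap _ ℂ ℂ :=
    ext_kronecker fun A B => by
      simp [trace_kronecker, hΦ.tracePreserving, hΨ.tracePreserving]
  obtain ⟨_, K, rfl⟩ := hΦ.exists_kraus
  obtain ⟨_, L, rfl⟩ := hΨ.exists_kraus
  rw [tensorMap_krausMap] at ht ⊢
  exact .of_kraus _ fun M => LinearMap.congr_fun ht M

/-- The Heisenberg picture of a measurement in the standard basis of the output of a channel. -/
theorem IsCPTP.exists_effects {Φ : Matrix m m ℂ →ₗ[ℂ] Matrix p p ℂ} (h : IsCPTP Φ) :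
    ∃ P : p → Matrix m m ℂ, (∀ a, (P a).PosSemidef) ∧ ∑ a, P a = 1 ∧
      ∀ M a, Φ M a a = (M * P a).trace := by
  obtain ⟨t, K, hK⟩ := h.exists_kraus
  have hM : ∀ M a, Φ M a a =
      (M * krausMap (fun i => (K i)ᴴ) (single a a (1 : ℂ))).trace := by
    intro M a
    simp only [hK, krausMap_apply, Matrix.mul_sum, trace_sum, Matrix.sum_apply]
    refine Finset.sum_congr rfl fun i _ => ?_
    rw [conjTranspose_conjTranspose, ← Matrix.mul_assoc, trace_mul_comm, ← Matrix.mul_assoc,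
      ← Matrix.mul_assoc, trace_mul_single]
    simp
  refine ⟨fun a => krausMap (fun i => (K i)ᴴ) (single a a 1), fun a => ?_, ?_, hM⟩
  · refine posSemidef_krausMap _ ?_
    rw [← diagonal_single]
    exact PosSemidef.diagonal (Pi.single_nonneg.mpr zero_le_one)
  · rw [Matrix.ext_iff_trace_mul_left]
    intro M
    rw [Matrix.mul_sum, trace_sum, Matrix.mul_one, ← h.tracePreserving]
    exact Finset.sum_congr rfl fun a _ => (hM M a).symm

end Kraus

/-! ### The CHSH inequality for quantum correlations -/

section Bell

variable {m n : Type*} [Fintype m] [DecidableEq m] [Fintype n] [DecidableEq n]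

omit [Fintype m] [DecidableEq m] [Fintype n] [DecidableEq n] in
theorem sub_kronecker (A A' : Matrix m m ℂ) (B : Matrix n n ℂ) :
    (A - A') ⊗ₖ B = A ⊗ₖ B - A' ⊗ₖ B := by
  ext
  simp [sub_mul]

omit [Fintype m] [DecidableEq m] [Fintype n] [DecidableEq n] in
theorem kronecker_sub (A : Matrix m m ℂ) (B B' : Matrix n n ℂ) :
    A ⊗ₖ (B - B') = A ⊗ₖ B - A ⊗ₖ B' := by
  ext
  simp [mul_sub]

/-- The `±1`-valued observable `P - Q` of a two-outcome measurement `P, Q` squares to at most `1`,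
because `1 - (P - Q) ^ 2 = 4 * P * Q` where `P * Q = Q * P * Q + P * Q * P`. -/
theorem posSemidef_one_sub_sq {P Q : Matrix m m ℂ} (hP : P.PosSemidef) (hQ : Q.PosSemidef)
    (h : P + Q = 1) : (1 - (P - Q) * (P - Q)).PosSemidef := by
  have h1 := hP.conjTranspose_mul_mul_same Q
  have h2 := hQ.conjTranspose_mul_mul_same P
  rw [hQ.isHermitian.eq] at h1
  rw [hP.isHermitian.eq] at h2
  obtain rfl : P = 1 - Q := eq_sub_of_add_eq h
  have h3 := (h1.add h2).smul (show (0 : ℂ) ≤ 4 by norm_num)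
  convert h3 using 1
  rw [ofNat_smul_eq_nsmul]
  noncomm_ring

open scoped MatrixOrder in
theorem trace_mul_nonneg {ρ M : Matrix m m ℂ} (hρ : ρ.PosSemidef) (hM : M.PosSemidef) :
    0 ≤ (ρ * M).trace := by
  obtain ⟨C, rfl⟩ := CStarAlgebra.nonneg_iff_eq_star_mul_self.mp hρ.nonneg
  rw [star_eq_conjTranspose, Matrix.mul_assoc, trace_mul_comm]
  exact (hM.mul_mul_conjTranspose_same C).trace_nonneg

/-- A weak form of Tsirelson's bound, from the positivity of the squares of
`A₀ - B₀ - B₁` and `A₁ - B₀ + B₁`. The bound `2 * √2` would need `B₀` and `B₁` to be weighted by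
`1 / √2` there; any bound below `4` serves to exclude the Popescu–Rohrlich box. -/
theorem chsh_le_three {ρ : Matrix (m × n) (m × n) ℂ} (hρ : IsDensity ρ)
    {A₀ A₁ : Matrix m m ℂ} {B₀ B₁ : Matrix n n ℂ}
    (hA₀ : A₀.IsHermitian) (hA₁ : A₁.IsHermitian) (hB₀ : B₀.IsHermitian) (hB₁ : B₁.IsHermitian)
    (hA₀' : (1 - A₀ * A₀).PosSemidef) (hA₁' : (1 - A₁ * A₁).PosSemidef)
    (hB₀' : (1 - B₀ * B₀).PosSemidef) (hB₁' : (1 - B₁ * B₁).PosSemidef) :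
    (ρ * (A₀ ⊗ₖ B₀)).trace + (ρ * (A₀ ⊗ₖ B₁)).trace + (ρ * (A₁ ⊗ₖ B₀)).trace
      - (ρ * (A₁ ⊗ₖ B₁)).trace ≤ 3 := by
  have sq : ∀ {M : Matrix (m × n) (m × n) ℂ}, M.IsHermitian → (M * M).PosSemidef := by
    intro M hM
    have := posSemidef_conjTranspose_mul_self M
    rwa [hM.eq] at this
  have hX : ∀ {A : Matrix m m ℂ}, A.IsHermitian → (A ⊗ₖ (1 : Matrix n n ℂ)).IsHermitian := by
    intro A hA
    rw [IsHermitian, conjTranspose_kronecker, hA.eq, conjTranspose_one]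
  have hY : ∀ {B : Matrix n n ℂ}, B.IsHermitian → ((1 : Matrix m m ℂ) ⊗ₖ B).IsHermitian := by
    intro A hA
    rw [IsHermitian, conjTranspose_kronecker, hA.eq, conjTranspose_one]
  have p1 := sq (((hX hA₀).sub (hY hB₀)).sub (hY hB₁))
  have p2 := sq (((hX hA₁).sub (hY hB₀)).add (hY hB₁))
  have p3 := hA₀'.kronecker (PosSemidef.one (n := n) (R := ℂ))
  have p4 := hA₁'.kronecker (PosSemidef.one (n := n) (R := ℂ))
  have p5 := (PosSemidef.one (n := m) (R := ℂ)).kronecker hB₀'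
  have p6 := (PosSemidef.one (n := m) (R := ℂ)).kronecker hB₁'
  have key := trace_mul_nonneg hρ.1
    (((p1.add p2).add (p3.add p4)).add ((p5.add p5).add (p6.add p6)))
  have hcomm : ∀ (A : Matrix m m ℂ) (B : Matrix n n ℂ), (1 ⊗ₖ B) * (A ⊗ₖ 1) = A ⊗ₖ B := by
    intro A B; rw [← mul_kronecker_mul, Matrix.mul_one, Matrix.one_mul]
  have hsum : (A₀ ⊗ₖ 1 - 1 ⊗ₖ B₀ - 1 ⊗ₖ B₁) * (A₀ ⊗ₖ 1 - 1 ⊗ₖ B₀ - 1 ⊗ₖ B₁)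
      + (A₁ ⊗ₖ 1 - 1 ⊗ₖ B₀ + 1 ⊗ₖ B₁) * (A₁ ⊗ₖ 1 - 1 ⊗ₖ B₀ + 1 ⊗ₖ B₁)
      + ((1 - A₀ * A₀) ⊗ₖ 1 + (1 - A₁ * A₁) ⊗ₖ 1)
      + (1 ⊗ₖ (1 - B₀ * B₀) + 1 ⊗ₖ (1 - B₀ * B₀) + (1 ⊗ₖ (1 - B₁ * B₁) + 1 ⊗ₖ (1 - B₁ * B₁)))
      = 2 • (3 • (1 : Matrix (m × n) (m × n) ℂ)
        - (A₀ ⊗ₖ B₀ + A₀ ⊗ₖ B₁ + A₁ ⊗ₖ B₀ - A₁ ⊗ₖ B₁)) := by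
    simp only [sub_kronecker, kronecker_sub, one_kronecker_one, Matrix.sub_mul, Matrix.mul_sub,
      Matrix.add_mul, Matrix.mul_add, hcomm, ← mul_kronecker_mul, Matrix.mul_one, Matrix.one_mul]
    abel
  rw [hsum] at key
  simp only [Matrix.mul_smul, trace_smul, Matrix.mul_sub, Matrix.mul_add, trace_sub, trace_add,
    Matrix.mul_one, hρ.2] at key
  rw [two_nsmul, ← two_mul] at key
  rw [← sub_nonneg]
  have h2 : (0 : ℂ) ≤ 2⁻¹ := by norm_num [Complex.le_def]
  convert mul_nonneg h2 key using 1
  rw [inv_mul_cancel_left₀ two_ne_zero]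
  norm_num

variable {p q : Type*} [Fintype p] [DecidableEq p] [Fintype q] [DecidableEq q]

/-- Outcome probabilities of local measurements: if `P` and `Q` are the effects of `Φ` and `Ψ`, then
the `P a ⊗ₖ Q b` are the effects of `Φ ⊗ Ψ`. -/
theorem tensorMap_apply_diag {Φ : Matrix m m ℂ →ₗ[ℂ] Matrix p p ℂ}
    {Ψ : Matrix n n ℂ →ₗ[ℂ] Matrix q q ℂ} {P : p → Matrix m m ℂ} {Q : q → Matrix n n ℂ}
    (hP : ∀ M a, Φ M a a = (M * P a).trace) (hQ : ∀ M b, Ψ M b b = (M * Q b).trace)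
    (M : Matrix (m × n) (m × n) ℂ) (a : p) (b : q) :
    tensorMap Φ Ψ M (a, b) (a, b) = (M * (P a ⊗ₖ Q b)).trace := by
  have : entryLinearMap ℂ ℂ (a, b) (a, b) ∘ₗ tensorMap Φ Ψ =
      traceLinearMap _ ℂ ℂ ∘ₗ LinearMap.mulRight ℂ (P a ⊗ₖ Q b) :=
    ext_kronecker fun A B => by
      simp [← mul_kronecker_mul, trace_kronecker, hP, hQ]
  exact LinearMap.congr_fun this M

end Bell

/-! ### Adjoining a shared state -/

section InsertShared

variable {x y k l : ℕ}

/-- `insertShared` as a linear map in the operator on the inputs. -/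
def insertSharedLinear (σ : Matrix (Fin k × Fin l) (Fin k × Fin l) ℂ) :
    Matrix (Fin x × Fin y) (Fin x × Fin y) ℂ →ₗ[ℂ]
      Matrix ((Fin x × Fin k) × (Fin l × Fin y)) ((Fin x × Fin k) × (Fin l × Fin y)) ℂ where
  toFun := insertShared σ
  map_add' M N := by ext; simp [insertShared, add_mul]
  map_smul' c M := by ext; simp [insertShared, mul_assoc]

/-- `insertShared` as a linear map in the shared state. -/
def insertInputLinear (M : Matrix (Fin x × Fin y) (Fin x × Fin y) ℂ) :
    Matrix (Fin k × Fin l) (Fin k × Fin l) ℂ →ₗ[ℂ]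
      Matrix ((Fin x × Fin k) × (Fin l × Fin y)) ((Fin x × Fin k) × (Fin l × Fin y)) ℂ where
  toFun σ := insertShared σ M
  map_add' M N := by ext; simp [insertShared, mul_add]
  map_smul' c M := by ext; simp [insertShared, mul_left_comm]

@[simp]
theorem insertSharedLinear_apply (σ : Matrix (Fin k × Fin l) (Fin k × Fin l) ℂ)
    (M : Matrix (Fin x × Fin y) (Fin x × Fin y) ℂ) :
    insertSharedLinear σ M = insertShared σ M := rfl

@[simp]
theorem insertInputLinear_apply (σ : Matrix (Fin k × Fin l) (Fin k × Fin l) ℂ)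
    (M : Matrix (Fin x × Fin y) (Fin x × Fin y) ℂ) :
    insertInputLinear M σ = insertShared σ M := rfl

@[simp]
theorem insertShared_kronecker (S : Matrix (Fin k) (Fin k) ℂ) (S' : Matrix (Fin l) (Fin l) ℂ)
    (A : Matrix (Fin x) (Fin x) ℂ) (B : Matrix (Fin y) (Fin y) ℂ) :
    insertShared (S ⊗ₖ S') (A ⊗ₖ B) = (A ⊗ₖ S) ⊗ₖ (S' ⊗ₖ B) := by
  ext
  simp [insertShared]
  ring

end InsertShared

section Input

variable {x y k l a b : ℕ}

/-- A channel is obtained by fixing the first input of a channel to the basis state `i`. -/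
theorem IsCPTP.exists_fix_fst {F : Matrix (Fin x × Fin k) (Fin x × Fin k) ℂ →ₗ[ℂ]
      Matrix (Fin a) (Fin a) ℂ} (hF : IsCPTP F) (i : Fin x) :
    ∃ Φ : Matrix (Fin k) (Fin k) ℂ →ₗ[ℂ] Matrix (Fin a) (Fin a) ℂ, IsCPTP Φ ∧
      ∀ S, Φ S = F (single i i 1 ⊗ₖ S) := by
  let V : Matrix (Fin x × Fin k) (Fin k) ℂ := of fun r j => if r = (i, j) then 1 else 0
  refine ⟨F ∘ₗ krausMap fun _ : Unit => V, hF.comp (isCPTP_conj V ?_), fun S => ?_⟩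
  · ext j j'
    simp [V, Matrix.mul_apply, one_apply, eq_comm]
  · rw [LinearMap.comp_apply]
    congr 1
    ext ⟨r, j⟩ ⟨r', j'⟩
    by_cases h : r = i <;> by_cases h' : r' = i <;>
      simp [V, krausMap_apply, Matrix.mul_apply, h, h', Ne.symm]

/-- A channel is obtained by fixing the second input of a channel to the basis state `i`. -/
theorem IsCPTP.exists_fix_snd {G : Matrix (Fin l × Fin y) (Fin l × Fin y) ℂ →ₗ[ℂ]
      Matrix (Fin b) (Fin b) ℂ} (hG : IsCPTP G) (i : Fin y) :
    ∃ Φ : Matrix (Fin l) (Fin l) ℂ →ₗ[ℂ] Matrix (Fin b) (Fin b) ℂ, IsCPTP Φ ∧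
      ∀ S, Φ S = G (S ⊗ₖ single i i 1) := by
  let V : Matrix (Fin l × Fin y) (Fin l) ℂ := of fun r j => if r = (j, i) then 1 else 0
  refine ⟨G ∘ₗ krausMap fun _ : Unit => V, hG.comp (isCPTP_conj V ?_), fun S => ?_⟩
  · ext j j'
    simp [V, Matrix.mul_apply, one_apply, eq_comm]
  · rw [LinearMap.comp_apply]
    congr 1
    ext ⟨j, r⟩ ⟨j', r'⟩
    by_cases h : r = i <;> by_cases h' : r' = i <;>
      simp [V, krausMap_apply, Matrix.mul_apply, h, h', Ne.symm]

end Input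

/-! ### The Popescu–Rohrlich box -/

section PRBox

/-- Kraus operators of the Popescu–Rohrlich box, indexed by the two inputs and Alice's output:
on the inputs `x, y` the outputs are `a` and `a + x * y` in `ℤ/2`, with `a` uniformly random. -/
noncomputable def prKraus (i : Fin 2 × Fin 2 × Fin 2) : Matrix (Fin 2 × Fin 2) (Fin 2 × Fin 2) ℂ :=
  single (i.2.2, i.2.2 + i.1 * i.2.1) (i.1, i.2.1) ((√2 : ℝ) : ℂ)⁻¹

/-- The Popescu–Rohrlich box, as a channel that dephases its inputs. -/
noncomputable def prBox : Matrix (Fin 2 × Fin 2) (Fin 2 × Fin 2) ℂ →ₗ[ℂ]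
    Matrix (Fin 2 × Fin 2) (Fin 2 × Fin 2) ℂ := krausMap prKraus

theorem prBox_apply (M : Matrix (Fin 2 × Fin 2) (Fin 2 × Fin 2) ℂ) :
    prBox M = ∑ x, ∑ y, ∑ a : Fin 2, (M (x, y) (x, y) / 2) •
      (single a a (1 : ℂ) ⊗ₖ single (a + x * y) (a + x * y) (1 : ℂ)) := by
  have h2 : ((√2 : ℝ) : ℂ)⁻¹ * ((√2 : ℝ) : ℂ)⁻¹ = 2⁻¹ := by
    rw [← mul_inv, ← Complex.ofReal_mul, Real.mul_self_sqrt (by norm_num)]; norm_num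
  simp only [prBox, krausMap_apply, Fintype.sum_prod_type, prKraus, conjTranspose_single]
  refine Finset.sum_congr rfl fun x _ => Finset.sum_congr rfl fun y _ =>
    Finset.sum_congr rfl fun a _ => ?_
  rw [single_mul_mul_single, single_kronecker_single, smul_single]
  congr 1
  simp only [RCLike.star_def, map_inv₀, Complex.conj_ofReal, smul_eq_mul, mul_one]
  rw [mul_right_comm, h2]
  ring

theorem isCPTP_prBox : IsCPTP prBox := by
  refine .of_kraus _ fun M => ?_
  change (prBox M).trace = _
  rw [prBox_apply]
  simp only [trace_sum, trace_smul, trace_kronecker, trace_single_eq_same]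
  simp only [trace, Fintype.sum_prod_type, Fin.sum_univ_two, diag_apply, smul_eq_mul]
  ring

theorem prBox_comp_proj (κ κ' : Kind) : prBox ∘ₗ tensorMap κ.proj κ'.proj = prBox := by
  refine ext_kronecker fun A B => ?_
  have h : ∀ (κ : Kind) (A : Matrix (Fin 2) (Fin 2) ℂ) (i : Fin 2), κ.proj A i i = A i i := by
    rintro (_ | _ | _) A i <;> simp [Kind.proj]
  simp [prBox_apply, h]

theorem proj_comp_prBox (κ κ' : Kind) : tensorMap κ.proj κ'.proj ∘ₗ prBox = prBox := by
  have h : ∀ (κ : Kind) (i : Fin 2), κ.proj (single i i (1 : ℂ)) = single i i 1 := by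
    rintro (_ | _ | _) i <;> simp [Kind.proj, ← diagonal_single]
  ext1 M
  simp [prBox_apply, h]

theorem traceFst_prBox (M : Matrix (Fin 2 × Fin 2) (Fin 2 × Fin 2) ℂ) :
    traceFst (prBox M) = ((traceFst M).trace / 2) • 1 := by
  ext b b'
  fin_cases b <;> fin_cases b' <;>
  simp [prBox_apply, traceFst, trace, single_apply] <;> ring

theorem traceSnd_prBox (M : Matrix (Fin 2 × Fin 2) (Fin 2 × Fin 2) ℂ) :
    traceSnd (prBox M) = ((traceSnd M).trace / 2) • 1 := by
  ext b b'
  fin_cases b <;> fin_cases b' <;>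
  simp [prBox_apply, traceSnd, trace, single_apply] <;> ring

theorem isResource_prBox {T : ResourceType} (hX : T.X ≠ .I) (hY : T.Y ≠ .I) (hA : T.A ≠ .I)
    (hB : T.B ≠ .I) : IsResource T prBox := by
  have h : ∀ κ : Kind, κ ≠ .I → κ.AllowsDim 2 := by
    rintro (_ | _ | _) h <;> simp_all [Kind.AllowsDim]
  exact
    { dimX := h _ hX
      dimY := h _ hY
      dimA := h _ hA
      dimB := h _ hB
      cptp := isCPTP_prBox
      input := prBox_comp_proj _ _
      output := proj_comp_prBox _ _
      noSignalAliceToBob := fun M N h => by rw [traceFst_prBox, traceFst_prBox, h]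
      noSignalBobToAlice := fun M N h => by rw [traceSnd_prBox, traceSnd_prBox, h] }

theorem prBox_single (x y a b : Fin 2) :
    prBox (single x x 1 ⊗ₖ single y y 1) (a, b) (a, b) = if b = a + x * y then 1 / 2 else 0 := by
  revert x y a b
  simp [prBox_apply, single_apply, Fin.forall_fin_two]

/-- The Popescu–Rohrlich box has CHSH value `4`, so local operations on a shared quantum state
cannot produce it. -/
theorem not_isLOSEFree_prBox (T : ResourceType) : ¬ IsLOSEFree T prBox := by
  rintro ⟨k, l, σ, F, G, hσ, hF, hG, h⟩
  choose Φ hΦ hΦF using hF.cptp.exists_fix_fst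
  choose Ψ hΨ hΨG using hG.cptp.exists_fix_snd
  choose P hP hP1 hPΦ using fun x => (hΦ x).exists_effects
  choose Q hQ hQ1 hQΨ using fun y => (hΨ y).exists_effects
  have hval : ∀ x y a b, (σ * (P x a ⊗ₖ Q y b)).trace = if b = a + x * y then 1 / 2 else 0 := by
    intro x y a b
    have hσ' : tensorMap (Φ x) (Ψ y) = tensorMap F G ∘ₗ
        insertInputLinear (single x x 1 ⊗ₖ single y y 1) :=
      ext_kronecker fun S S' => by simp [hΦF, hΨG]
    rw [← prBox_single, h, ← tensorMap_apply_diag (hPΦ x) (hQΨ y), hσ']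
    rfl
  -- Correlations of the `±1`-valued observables in which each party encodes its output.
  have hobs : ∀ x y, (σ * ((P x 0 - P x 1) ⊗ₖ (Q y 0 - Q y 1))).trace =
      if x * y = 0 then 1 else -1 := by
    intro x y
    simp only [sub_kronecker, kronecker_sub, Matrix.mul_sub, trace_sub, hval]
    revert x y
    simp [Fin.forall_fin_two]
    norm_num
  have key := chsh_le_three hσ
    ((hP 0 0).isHermitian.sub (hP 0 1).isHermitian) ((hP 1 0).isHermitian.sub (hP 1 1).isHermitian)
    ((hQ 0 0).isHermitian.sub (hQ 0 1).isHermitian) ((hQ 1 0).isHermitian.sub (hQ 1 1).isHermitian)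
    (posSemidef_one_sub_sq (hP 0 0) (hP 0 1) (by simpa using hP1 0))
    (posSemidef_one_sub_sq (hP 1 0) (hP 1 1) (by simpa using hP1 1))
    (posSemidef_one_sub_sq (hQ 0 0) (hQ 0 1) (by simpa using hQ1 0))
    (posSemidef_one_sub_sq (hQ 1 0) (hQ 1 1) (by simpa using hQ1 1))
  simp only [hobs] at key
  norm_num [Complex.le_def] at key

end PRBox

/-! ### Kinds of systems -/

section Proj

variable {n : Type*} [Fintype n] [DecidableEq n]

theorem sum_single_one : ∑ i : n, single i i (1 : ℂ) = 1 := by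
  ext i j
  by_cases h : i = j <;> simp [Matrix.sum_apply, single_apply, one_apply, ite_and, h]

theorem isCPTP_proj (κ : Kind) : IsCPTP (κ.proj : Matrix n n ℂ →ₗ[ℂ] Matrix n n ℂ) := by
  have h : IsCPTP (krausMap fun i : n => single i i (1 : ℂ)) :=
    .of_sum_eq_one _ (by simpa using sum_single_one)
  rcases κ with _ | _ | _
  · exact .id
  · convert h using 1
    ext1 M
    ext i j
    by_cases hij : i = j <;>
    simp [Kind.proj, krausMap_apply, single_mul_mul_single, single_apply, Matrix.sum_apply,
      ite_and, hij]
  · exact .id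

omit [Fintype n] in
theorem proj_comp_proj (κ : Kind) :
    κ.proj ∘ₗ κ.proj = (κ.proj : Matrix n n ℂ →ₗ[ℂ] Matrix n n ℂ) := by
  rcases κ with _ | _ | _ <;> ext1 M <;> simp [Kind.proj]

theorem Kind.AllowsDim.pos {κ : Kind} {d : ℕ} (h : κ.AllowsDim d) : 0 < d := by
  rcases κ with _ | _ | _ <;> simp only [Kind.AllowsDim] at h <;> omega

end Proj

/-! ### Resources with a trivial output -/

section Generation

variable {x y a b k l : ℕ}

theorem insertShared_tensorMap (Φ : Matrix (Fin x) (Fin x) ℂ →ₗ[ℂ] Matrix (Fin x) (Fin x) ℂ)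
    (Ψ : Matrix (Fin y) (Fin y) ℂ →ₗ[ℂ] Matrix (Fin y) (Fin y) ℂ)
    (σ : Matrix (Fin k × Fin l) (Fin k × Fin l) ℂ) (M : Matrix (Fin x × Fin y) (Fin x × Fin y) ℂ) :
    insertShared σ (tensorMap Φ Ψ M) =
      tensorMap (tensorMap Φ .id) (tensorMap .id Ψ) (insertShared σ M) := by
  have h : insertInputLinear (k := k) (l := l) (tensorMap Φ Ψ M) =
      tensorMap (tensorMap Φ .id) (tensorMap .id Ψ) ∘ₗ insertInputLinear M :=
    ext_kronecker fun S S' => by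
      have h' : insertSharedLinear (S ⊗ₖ S') ∘ₗ tensorMap Φ Ψ =
          tensorMap (tensorMap Φ .id) (tensorMap .id Ψ) ∘ₗ insertSharedLinear (S ⊗ₖ S') :=
        ext_kronecker fun A B => by simp
      exact LinearMap.congr_fun h' M
  exact LinearMap.congr_fun h σ

/-- A resource is generated by LOSE as soon as local channels exist that reproduce it, whether or
not they respect the kinds of the systems: projecting the systems makes them do so, and the
resource is unaffected. -/
theorem IsResource.isLOSEFree {T : ResourceType}
    {E : Matrix (Fin x × Fin y) (Fin x × Fin y) ℂ →ₗ[ℂ] Matrix (Fin a × Fin b) (Fin a × Fin b) ℂ}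
    (hE : IsResource T E) {σ : Matrix (Fin k × Fin l) (Fin k × Fin l) ℂ} (hσ : IsDensity σ)
    {F : Matrix (Fin x × Fin k) (Fin x × Fin k) ℂ →ₗ[ℂ] Matrix (Fin a) (Fin a) ℂ} (hF : IsCPTP F)
    {G : Matrix (Fin l × Fin y) (Fin l × Fin y) ℂ →ₗ[ℂ] Matrix (Fin b) (Fin b) ℂ} (hG : IsCPTP G)
    (h : E = tensorMap F G ∘ₗ insertSharedLinear σ) : IsLOSEFree T E := by
  refine ⟨k, l, σ, T.A.proj ∘ₗ F ∘ₗ tensorMap T.X.proj .id,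
    T.B.proj ∘ₗ G ∘ₗ tensorMap .id T.Y.proj, hσ, ⟨?_, ?_, ?_⟩, ⟨?_, ?_, ?_⟩, fun M => ?_⟩
  · exact (isCPTP_proj _).comp (hF.comp ((isCPTP_proj _).tensorMap .id))
  · rw [LinearMap.comp_assoc, LinearMap.comp_assoc, tensorMap_comp, proj_comp_proj,
      LinearMap.id_comp]
  · rw [← LinearMap.comp_assoc, proj_comp_proj]
  · exact (isCPTP_proj _).comp (hG.comp (IsCPTP.id.tensorMap (isCPTP_proj _)))
  · rw [LinearMap.comp_assoc, LinearMap.comp_assoc, tensorMap_comp, proj_comp_proj,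
      LinearMap.id_comp]
  · rw [← LinearMap.comp_assoc, proj_comp_proj]
  · have hins := insertShared_tensorMap T.X.proj T.Y.proj σ M
    rw [← tensorMap_comp, ← tensorMap_comp, LinearMap.comp_apply, LinearMap.comp_apply, ← hins,
      ← insertSharedLinear_apply, ← LinearMap.comp_apply (tensorMap F G), ← h,
      ← LinearMap.comp_apply E, hE.input, ← LinearMap.comp_apply, hE.output]

/-- If Alice's output is trivial, then Bob's output depends only on his own input, so he can
produce it alone, from an arbitrary input of Alice. -/
theorem isLOSETrivial_of_A {T : ResourceType} (hT : T.A = .I) : T.IsLOSETrivial := by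
  intro x y a b E hE
  obtain rfl : a = 1 := by simpa [hT, Kind.AllowsDim] using hE.dimA
  have hx : 0 < x := hE.dimX.pos
  -- `V` adjoins the basis state `0` of Alice's input; `W` discards the one-dimensional factor.
  let V : Matrix (Fin x × Fin y) (Fin 1 × Fin y) ℂ :=
    of fun r s => if r = (⟨0, hx⟩, s.2) then 1 else 0
  let W : Matrix (Fin b) (Fin 1 × Fin b) ℂ := of fun r s => if r = s.2 then 1 else 0
  have hF : IsCPTP (krausMap fun i : Fin x × Fin 1 => single (0 : Fin 1) i (1 : ℂ)) :=
    .of_sum_eq_one _ (by simpa using sum_single_one)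
  have hV : IsCPTP (krausMap fun _ : Unit => V) := isCPTP_conj V (by
    ext ⟨i, j⟩ ⟨i', j'⟩
    simp [V, Matrix.mul_apply, one_apply, Subsingleton.elim i i', eq_comm])
  have hW : IsCPTP (krausMap fun _ : Unit => W) := isCPTP_conj W (by
    ext ⟨i, j⟩ ⟨i', j'⟩
    simp [W, Matrix.mul_apply, one_apply, Subsingleton.elim i i', eq_comm])
  refine hE.isLOSEFree (k := 1) (l := 1) (σ := 1) ⟨.one, by simp [trace]⟩ hF
    (hW.comp (hE.cptp.comp hV)) (ext_kronecker fun A B => ?_)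
  have hW' : ∀ M, krausMap (fun _ : Unit => W) M = traceFst M := by
    intro M
    ext i j
    simp [W, krausMap_apply, Matrix.mul_apply, traceFst, Fintype.sum_prod_type, apply_ite]
  have hV' : krausMap (fun _ : Unit => V) ((1 : Matrix (Fin 1) (Fin 1) ℂ) ⊗ₖ B) =
      single ⟨0, hx⟩ ⟨0, hx⟩ 1 ⊗ₖ B := by
    ext ⟨i, j⟩ ⟨i', j'⟩
    by_cases h : i = ⟨0, hx⟩ <;> by_cases h' : i' = ⟨0, hx⟩ <;>
    simp [V, krausMap_apply, Matrix.mul_apply, Fintype.sum_prod_type, h, h', Ne.symm]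
  have hF' : krausMap (fun i : Fin x × Fin 1 => single (0 : Fin 1) i (1 : ℂ)) (A ⊗ₖ 1) =
      A.trace • 1 := by
    ext i j
    simp [krausMap_apply, Fintype.sum_prod_type, Matrix.sum_apply, trace,
      Subsingleton.elim i 0, Subsingleton.elim j 0]
  have hE' := hE.noSignalAliceToBob (A ⊗ₖ B) (A.trace • (single ⟨0, hx⟩ ⟨0, hx⟩ 1 ⊗ₖ B)) (by
    ext i j
    simp [traceFst, trace, single_apply, ← Finset.sum_mul])
  rw [LinearMap.comp_apply, insertSharedLinear_apply, ← one_kronecker_one, insertShared_kronecker,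
    tensorMap_kronecker, hF', LinearMap.comp_apply, LinearMap.comp_apply, hV', hW']
  ext ⟨i, j⟩ ⟨i', j'⟩
  have := congrFun (congrFun hE' j) j'
  obtain rfl := Subsingleton.elim i 0
  obtain rfl := Subsingleton.elim i' 0
  simpa [traceFst] using this

end Generation

/-! ### Exchanging Alice and Bob -/

section Swap

variable {m n p q : Type*} [Fintype m] [DecidableEq m] [Fintype n] [DecidableEq n]
  [Fintype p] [DecidableEq p] [Fintype q] [DecidableEq q]

/-- The exchange of two tensor factors. -/
def swapMap (m n : Type*) [Fintype m] [Fintype n] :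
    Matrix (m × n) (m × n) ℂ →ₗ[ℂ] Matrix (n × m) (n × m) ℂ :=
  (reindexLinearEquiv ℂ ℂ (Equiv.prodComm m n) (Equiv.prodComm m n)).toLinearMap

omit [DecidableEq m] [DecidableEq n] in
@[simp]
theorem swapMap_apply (M : Matrix (m × n) (m × n) ℂ) (i j : n × m) :
    swapMap m n M i j = M i.swap j.swap := rfl

omit [DecidableEq m] [DecidableEq n] in
@[simp]
theorem swapMap_kronecker (A : Matrix m m ℂ) (B : Matrix n n ℂ) :
    swapMap m n (A ⊗ₖ B) = B ⊗ₖ A := by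
  ext
  simp [mul_comm]

omit [DecidableEq m] [DecidableEq n] in
@[simp]
theorem swapMap_swapMap (M : Matrix (m × n) (m × n) ℂ) : swapMap n m (swapMap m n M) = M := rfl

theorem isCPTP_swapMap : IsCPTP (swapMap m n) := by
  have h : swapMap m n = krausMap fun _ : Unit =>
      (1 : Matrix (m × n) (m × n) ℂ).submatrix (Equiv.prodComm n m) id := by
    ext1 M
    ext i j
    simp [krausMap_apply, Matrix.mul_apply, one_apply]
  rw [h]
  refine isCPTP_conj _ ?_
  rw [conjTranspose_submatrix, conjTranspose_one, submatrix_mul_equiv, Matrix.one_mul,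
    submatrix_id_id]

theorem swapMap_tensorMap (Φ : Matrix m m ℂ →ₗ[ℂ] Matrix p p ℂ)
    (Ψ : Matrix n n ℂ →ₗ[ℂ] Matrix q q ℂ) (M : Matrix (m × n) (m × n) ℂ) :
    swapMap p q (tensorMap Φ Ψ M) = tensorMap Ψ Φ (swapMap m n M) := by
  have : swapMap p q ∘ₗ tensorMap Φ Ψ = tensorMap Ψ Φ ∘ₗ swapMap m n :=
    ext_kronecker fun A B => by simp
  exact LinearMap.congr_fun this M

theorem tensorMap_swapMap_insertShared {x y k l : ℕ}
    (σ : Matrix (Fin k × Fin l) (Fin k × Fin l) ℂ) (M : Matrix (Fin x × Fin y) (Fin x × Fin y) ℂ) :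
    tensorMap (swapMap _ _) (swapMap _ _) (insertShared (swapMap _ _ σ) M) =
      swapMap _ _ (insertShared σ (swapMap _ _ M)) := by
  have h : tensorMap (swapMap _ _) (swapMap _ _) ∘ₗ insertInputLinear M ∘ₗ swapMap _ _ =
      swapMap _ _ ∘ₗ insertInputLinear (k := k) (l := l) (swapMap _ _ M) :=
    ext_kronecker fun S S' => by
      have h' : tensorMap (swapMap _ _) (swapMap _ _) ∘ₗ insertSharedLinear (S' ⊗ₖ S) =
          swapMap _ _ ∘ₗ insertSharedLinear (S ⊗ₖ S') ∘ₗ swapMap (Fin x) (Fin y) :=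
        ext_kronecker fun A B => by simp
      simpa using LinearMap.congr_fun h' M
  exact LinearMap.congr_fun h σ

/-- The resource type with the roles of Alice and Bob exchanged. -/
def ResourceType.swap (T : ResourceType) : ResourceType := ⟨T.Y, T.X, T.B, T.A⟩

theorem isLOSETrivial_of_swap {T : ResourceType} (h : T.swap.IsLOSETrivial) : T.IsLOSETrivial := by
  intro x y a b E hE
  have hE' : IsResource T.swap (swapMap (Fin a) (Fin b) ∘ₗ E ∘ₗ swapMap (Fin y) (Fin x)) :=
    { dimX := hE.dimY
      dimY := hE.dimX
      dimA := hE.dimB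
      dimB := hE.dimA
      cptp := isCPTP_swapMap.comp (hE.cptp.comp isCPTP_swapMap)
      input := by
        ext1 M
        have := LinearMap.congr_fun hE.input (swapMap _ _ M)
        simp only [LinearMap.comp_apply, swapMap_tensorMap] at this ⊢
        exact congrArg _ this
      output := by
        ext1 M
        have := LinearMap.congr_fun hE.output (swapMap _ _ M)
        simp only [LinearMap.comp_apply, ← swapMap_tensorMap] at this ⊢
        exact congrArg _ this
      noSignalAliceToBob := fun M N hMN => hE.noSignalBobToAlice (swapMap _ _ M) (swapMap _ _ N) hMN
      noSignalBobToAlice := fun M N hMN =>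
        hE.noSignalAliceToBob (swapMap _ _ M) (swapMap _ _ N) hMN }
  obtain ⟨k, l, σ, F, G, hσ, hF, hG, hfree⟩ := h _ _ _ _ _ hE'
  refine hE.isLOSEFree (k := l) (l := k) (σ := swapMap _ _ σ)
    ⟨hσ.1.submatrix _, (isCPTP_swapMap.tracePreserving σ).trans hσ.2⟩
    (hG.cptp.comp isCPTP_swapMap) (hF.cptp.comp isCPTP_swapMap) ?_
  ext1 M
  have := congrArg (swapMap _ _) (hfree (swapMap _ _ M))
  simp only [LinearMap.comp_apply, swapMap_swapMap, swapMap_tensorMap] at this ⊢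
  rw [this, ← tensorMap_comp, LinearMap.comp_apply, insertSharedLinear_apply,
    tensorMap_swapMap_insertShared]

end Swap

/-! ### Resources with a trivial input -/

section PureState

variable {x y a b k l : ℕ} {ι κ : Type*} [Fintype ι] [Fintype κ]

/-- The operator `φ ↦ φ ⊗ ψ` that adjoins the bipartite vector `ψ` to a vector on the inputs. -/
def insertVec (x y : ℕ) (ψ : Fin k × Fin l → ℂ) :
    Matrix ((Fin x × Fin k) × (Fin l × Fin y)) (Fin x × Fin y) ℂ :=
  of fun r s => if s = (r.1.1, r.2.2) then ψ (r.1.2, r.2.1) else 0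

theorem insertSharedLinear_vecMulVec (ψ : Fin k × Fin l → ℂ) :
    insertSharedLinear (vecMulVec ψ (star ψ)) = krausMap fun _ : Unit => insertVec x y ψ := by
  ext1 M
  ext r s
  simp [insertShared, krausMap_apply, Matrix.mul_apply, insertVec, vecMulVec_apply, apply_ite]
  ring

theorem tensorMap_krausMap_comp_insertSharedLinear
    (F : ι → Matrix (Fin a) (Fin x × Fin k) ℂ) (G : κ → Matrix (Fin b) (Fin l × Fin y) ℂ)
    (ψ : Fin k × Fin l → ℂ) :
    tensorMap (krausMap F) (krausMap G) ∘ₗ insertSharedLinear (vecMulVec ψ (star ψ)) =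
      krausMap fun i : (ι × κ) × Unit => (F i.1.1 ⊗ₖ G i.1.2) * insertVec x y ψ := by
  rw [tensorMap_krausMap, insertSharedLinear_vecMulVec, krausMap_comp]

end PureState

section Purification

variable {A R Y : Type*} [Fintype A] [DecidableEq A] [Fintype R] [DecidableEq Y]

/-- If all the operators `C y` have the same Gram matrix `ρ` and are mutually orthogonal, then they
factor through `U * diagonal s`, a square root of `ρ` up to a unitary, and the Gram matrix of the
cofactors `D y` is the support projection of `diagonal s`. This is the essential uniqueness of
purifications: viewed as a bipartite vector, `C y` arises from the purification
`∑ i, s i • (U i ⊗ i)` of `ρ`, with `U i` the `i`-th column of `U`, by applying the transpose of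
`D y` to the second factor. -/
theorem exists_factorization {C : Y → Matrix A R ℂ} {ρ : Matrix A A ℂ} (hρ : ρ.PosSemidef)
    (hC : ∀ y y', C y * (C y')ᴴ = if y = y' then ρ else 0) :
    ∃ (U : Matrix A A ℂ) (s : A → ℝ) (D : Y → Matrix A R ℂ), Uᴴ * U = 1 ∧
      (∀ y, C y = U * diagonal (fun i => (s i : ℂ)) * D y) ∧
      (∀ y y', D y * (D y')ᴴ =
        if y = y' then diagonal (fun i => if s i = 0 then 0 else 1) else 0) ∧
      ∑ i, (s i : ℂ) * s i = ρ.trace := by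
  let U : Matrix A A ℂ := hρ.isHermitian.eigenvectorUnitary
  have hU : Uᴴ * U = 1 := (mem_unitaryGroup_iff' (A := U)).mp (SetLike.coe_mem _)
  have hU' : U * Uᴴ = 1 := (mem_unitaryGroup_iff (A := U)).mp (SetLike.coe_mem _)
  let ev := hρ.isHermitian.eigenvalues
  have hev : ∀ i, 0 ≤ ev i := hρ.eigenvalues_nonneg
  have hdiag : Uᴴ * ρ * U = diagonal fun i => (ev i : ℂ) := by
    have h : ρ = U * (diagonal fun i => (ev i : ℂ)) * Uᴴ := hρ.isHermitian.spectral_theorem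
    rw [h]
    simp only [← Matrix.mul_assoc, hU, Matrix.one_mul]
    rw [Matrix.mul_assoc, hU, Matrix.mul_one]
  let s : A → ℝ := fun i => √(ev i)
  have hs : ∀ i, (s i : ℂ) * s i = ev i := fun i => by
    rw [← Complex.ofReal_mul, Real.mul_self_sqrt (hev i)]
  -- As `0⁻¹ = 0`, this is the pseudo-inverse of `diagonal s`, also for singular `ρ`.
  let S : Matrix A A ℂ := diagonal fun i => ((s i : ℂ))⁻¹
  have hS : Sᴴ = S := by
    simp [S, diagonal_conjTranspose, Pi.star_def]
  refine ⟨U, s, fun y => S * Uᴴ * C y, hU, fun y => ?_, fun y y' => ?_, ?_⟩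
  · -- The kernel of `ρ` is killed by `(C y)ᴴ`, since `C y * (C y)ᴴ = ρ`.
    have hrow : ∀ i j, s i = 0 → (Uᴴ * C y) i j = 0 := by
      intro i j hi
      have h : (Uᴴ * C y * (Uᴴ * C y)ᴴ) i i = 0 := by
        rw [conjTranspose_mul, conjTranspose_conjTranspose, Matrix.mul_assoc,
          ← Matrix.mul_assoc (C y), hC, if_pos rfl, ← Matrix.mul_assoc, hdiag, diagonal_apply_eq,
          ← hs, hi]
        simp
      rw [Matrix.mul_apply] at h
      simp only [conjTranspose_apply] at h
      exact CStarRing.mul_star_self_eq_zero_iff _ |>.mp ((Finset.sum_eq_zero_iff_of_nonneg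
        fun j _ => mul_star_self_nonneg _).mp h j (Finset.mem_univ _))
    have hP : diagonal (fun i => (s i : ℂ)) * (S * (Uᴴ * C y)) = Uᴴ * C y := by
      ext i j
      rw [diagonal_mul, diagonal_mul]
      by_cases hi : s i = 0
      · rw [hrow i j hi]; simp
      · rw [mul_inv_cancel_left₀ (Complex.ofReal_ne_zero.mpr hi)]
    beta_reduce
    rw [Matrix.mul_assoc, Matrix.mul_assoc S, hP, ← Matrix.mul_assoc, hU', Matrix.one_mul]
  · have h : S * Uᴴ * C y * (S * Uᴴ * C y')ᴴ = S * (Uᴴ * (C y * (C y')ᴴ) * U) * S := by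
      simp only [conjTranspose_mul, conjTranspose_conjTranspose, hS, Matrix.mul_assoc]
    rw [h, hC]
    split_ifs
    · rw [hdiag, diagonal_mul_diagonal, diagonal_mul_diagonal]
      congr 1
      ext i
      by_cases hi : s i = 0
      · simp [hi]
      · have : (s i : ℂ) ≠ 0 := Complex.ofReal_ne_zero.mpr hi
        rw [← hs, if_neg hi]
        field_simp
    · simp
  · simp only [hs]
    exact hρ.isHermitian.trace_eq_sum_eigenvalues.symm

end Purification

section TrivialInput

/-- If Alice's input is trivial, then her output is in a fixed state `ρ`, as Bob cannot signal to
her. She and Bob share a purification `ψ` of `ρ`; she outputs her half, and Bob applies the channel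
that turns his half, together with his input, into his output. -/
theorem isLOSETrivial_of_X {T : ResourceType} (hT : T.X = .I) : T.IsLOSETrivial := by
  intro x y a b E hE
  obtain rfl : x = 1 := by simpa [hT, Kind.AllowsDim] using hE.dimX
  let y₀ : Fin y := ⟨0, hE.dimY.pos⟩
  let b₀ : Fin b := ⟨0, hE.dimB.pos⟩
  obtain ⟨t, V, hV⟩ := hE.cptp.exists_kraus
  -- The Kraus operators of `E` with Bob's output and the Kraus index moved to the column side.
  let C : Fin y → Matrix (Fin a) (Fin t × Fin b) ℂ := fun j => of fun i r => V r.1 (i, r.2) (0, j)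
  have hCE : ∀ j j', C j * (C j')ᴴ = traceSnd (E (single (0, j) (0, j') 1)) := by
    intro j j'
    ext i i'
    simp only [Matrix.mul_apply, conjTranspose_apply, C, of_apply, Fintype.sum_prod_type, traceSnd,
      hV, krausMap_apply, Matrix.sum_apply]
    rw [Finset.sum_comm]
    simp [single_apply, ite_and]
  have hC : ∀ j j', C j * (C j')ᴴ = if j = j' then C y₀ * (C y₀)ᴴ else 0 := by
    intro j j'
    have htr : ∀ k k' : Fin y, traceSnd (single ((0 : Fin 1), k) ((0 : Fin 1), k') (1 : ℂ)) =
        if k = k' then 1 else 0 := by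
      intro k k'
      ext i i'
      obtain rfl := Subsingleton.elim i 0
      obtain rfl := Subsingleton.elim i' 0
      by_cases h : k = k' <;> simp [traceSnd, single_apply, ite_and, h, Ne.symm]
    split_ifs with h
    · rw [hCE, hCE]
      exact hE.noSignalBobToAlice _ _ (by simp [htr, h])
    · rw [hCE, hE.noSignalBobToAlice _ 0 (by rw [htr, if_neg h]; ext; simp [traceSnd]), map_zero]
      ext
      simp [traceSnd]
  have htr : (C y₀ * (C y₀)ᴴ).trace = 1 := by
    have h : ∀ M : Matrix (Fin a × Fin b) (Fin a × Fin b) ℂ, (traceSnd M).trace = M.trace := by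
      intro M
      simp [traceSnd, trace, Fintype.sum_prod_type]
    rw [hCE, h, hE.cptp.tracePreserving, trace_single_eq_same]
  obtain ⟨U, s, D, hU, hCD, hD, hs⟩ :=
    exists_factorization (posSemidef_self_mul_conjTranspose (C y₀)) hC
  let ψ : Fin a × Fin a → ℂ := fun i => if i.1 = i.2 then s i.1 else 0
  let F : Unit → Matrix (Fin a) (Fin 1 × Fin a) ℂ := fun _ => of fun i r => U i r.2
  -- The second family of Kraus operators makes Bob's channel trace preserving outside of the
  -- support of the reduced state of `ψ`, which is where `s` vanishes.
  let G : Fin t ⊕ (Fin a × Fin y) → Matrix (Fin b) (Fin a × Fin y) ℂ := Sum.elim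
    (fun r => of fun j c => D c.2 c.1 (r, j))
    (fun c => if s c.1 = 0 then single b₀ c 1 else 0)
  have hF : IsCPTP (krausMap F) := isCPTP_conj _ (by
    ext ⟨i, j⟩ ⟨i', j'⟩
    have := congrFun (congrFun hU j) j'
    simpa [Matrix.mul_apply, one_apply, Subsingleton.elim i i'] using this)
  have hG : IsCPTP (krausMap G) := by
    refine .of_sum_eq_one _ ?_
    ext ⟨i, j⟩ ⟨i', j'⟩
    have h1 : (∑ r, (G (.inl r))ᴴ * G (.inl r)) (i, j) (i', j') =
        if (i, j) = (i', j') then if s i = 0 then 0 else 1 else 0 := by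
      have := congrFun (congrFun (hD j' j) i') i
      simp only [Matrix.mul_apply, Fintype.sum_prod_type, conjTranspose_apply] at this
      simp only [Matrix.sum_apply, Matrix.mul_apply, conjTranspose_apply, G, Sum.elim_inl, of_apply]
      simp only [mul_comm (star _)]
      rw [this]
      by_cases hj : j = j' <;> by_cases hi : i = i' <;> simp [hi, hj, Ne.symm]
    have h2 : (∑ c, (G (.inr c))ᴴ * G (.inr c)) (i, j) (i', j') =
        if (i, j) = (i', j') then if s i = 0 then 1 else 0 else 0 := by
      rw [Matrix.sum_apply, Finset.sum_eq_single (i, j)]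
      · by_cases h : s i = 0 <;> simp [G, h, single_apply]
      · rintro ⟨i'', j''⟩ - hne
        by_cases h : s i'' = 0 <;> simp [G, h, hne]
      · simp
    rw [Fintype.sum_sum_type, Matrix.add_apply, h1, h2, one_apply]
    split_ifs <;> simp
  have hσ : IsDensity (vecMulVec ψ (star ψ)) := by
    refine ⟨posSemidef_vecMulVec_self_star ψ, ?_⟩
    rw [← htr, ← hs]
    simp [trace, vecMulVec_apply, Fintype.sum_prod_type, ψ, apply_ite]
  have hl : ∀ r, (F () ⊗ₖ G (.inl r)) * insertVec 1 y ψ = V r := by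
    intro r
    ext ⟨i, j⟩ ⟨i', j'⟩
    have := congrFun (congrFun (hCD j') i) (r, j)
    obtain rfl := Subsingleton.elim i' 0
    simp only [C, of_apply] at this
    rw [this]
    simp [Matrix.mul_apply, Fintype.sum_prod_type, insertVec, ψ, F, G, diagonal_apply,
      mul_right_comm]

  have hr : ∀ c, (F () ⊗ₖ G (.inr c)) * insertVec 1 y ψ = 0 := by
    intro c
    ext ⟨i, j⟩ ⟨i', j'⟩
    obtain rfl := Subsingleton.elim i' 0
    simp [Matrix.mul_apply, Fintype.sum_prod_type, insertVec, ψ, F, G]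
    refine Finset.sum_eq_zero fun x _ => ?_
    by_cases hc : s c.1 = 0
    · by_cases hx : c.1 = x
      · simp [← hx, hc]
      · have : c ≠ (x, j') := fun h => hx (congrArg Prod.fst h)
        simp [hc, this]
    · simp [hc]

  refine hE.isLOSEFree hσ hF hG ?_
  rw [tensorMap_krausMap_comp_insertSharedLinear, hV]
  ext1 M
  simp only [krausMap_apply, Fintype.sum_prod_type, Fintype.sum_sum_type, Fintype.sum_unique]
  simp only [PUnit.default_eq_unit, hl, hr]
  simp

end TrivialInput

end LOSE

theorem theorem1 (T : LOSE.ResourceType) :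
    T.IsLOSETrivial ↔
      T.X = LOSE.Kind.I ∨ T.Y = LOSE.Kind.I ∨ T.A = LOSE.Kind.I ∨ T.B = LOSE.Kind.I := by
  constructor
  · intro h
    by_contra! hT
    exact LOSE.not_isLOSEFree_prBox T
      (h _ _ _ _ _ (LOSE.isResource_prBox hT.1 hT.2.1 hT.2.2.1 hT.2.2.2))
  · rintro (h | h | h | h)
    · exact LOSE.isLOSETrivial_of_X h
    · exact LOSE.isLOSETrivial_of_swap (LOSE.isLOSETrivial_of_X h)
    · exact LOSE.isLOSETrivial_of_A h
    · exact LOSE.isLOSETrivial_of_swap (LOSE.isLOSETrivial_of_A h)
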